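/- For a Borel probability measure $Q$ on $\mathbb R$ and $n\in\mathbb N$ let $V_n(Q)=\inf\{\int\min_{a\in\alpha}|x-a|^2\,dQ(x):\alpha\subset\mathbb R,\ \emptyset\ne\alpha,\ \operatorname{card}(\alpha)\le n\}$. The quantization dimension of $Q$ exists and equals $D(Q)$ if the lower and upper limits of $\frac{2\log n}{-\log V_n(Q)}$ as $n\to\infty$ are both equal to $D(Q)$. For $s>0$, the $s$-dimensional lower and upper quantization coefficients of $Q$ are $\liminf_n n^{2/s}V_n(Q)$ and $\limsup_n n^{2/s}V_n(Q)$; the $s$-dimensional quantization coefficient exists if the sequence $n^{2/s}V_n(Q)$ has a limit in $[0,\infty]$. Let $S_1(x)=\frac13x$ and $S_2(x)=\frac13x+\frac13$ on $\mathbb R$, let $C=\bigcap_{k\in\mathbb N}\bigcup_{\sigma\in\{1,2\}^k}S_{\sigma_1}\circ\cdots\circ S_{\sigma_k}([0,\frac12])$ be the Cantor set that they generate, and let $P_1$ be the Cantor distribution, that is, a Borel probability measure on $\mathbb R$ with $P_1=\frac12P_1\circ S_1^{-1}+\frac12P_1\circ S_2^{-1}$. Let $P_2$ be the uniform distribution on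 the three-point set $\{\frac23,\frac56,1\}$, and let $P=\frac12P_1+\frac12P_2$. Put $\beta=\frac{\log 2}{\log 3}$. Then: (i) the Hausdorff dimension of $C$ is $\beta$; (ii) the quantization dimensions of $P_1$ and of $P$ exist, and $D(P)=D(P_1)=\beta$; (iii) $\liminf_{n\to\infty}n^{2/\beta}V_n(P)=\frac12\liminf_{n\to\infty}n^{2/\beta}V_n(P_1)$ and $\limsup_{n\to\infty}n^{2/\beta}V_n(P)=\frac12\limsup_{n\to\infty}n^{2/\beta}V_n(P_1)$; (iv) neither the $\beta$-dimensional quantization coefficient of $P_1$ nor that of $P$ exists. -/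

import Mathlib

open MeasureTheory Filter Topology
open scoped ENNReal

namespace Quantization

noncomputable section

section General

variable {E : Type*} [NormedAddCommGroup E] [MeasurableSpace E]

/-- The distortion error `∫ min_{a ∈ α} ‖x - a‖² dP(x)` of a finite set `α`. The minimum over the
empty set is `∞`, so the empty set is never a competitor for a probability measure. -/
def distortion (P : Measure E) (α : Finset E) : ℝ≥0∞ :=
  ∫⁻ x, ⨅ a ∈ α, ‖x - a‖ₑ ^ 2 ∂P

/-- The `n`th quantization error `V_n(P)`: the infimum of the distortion errors of the sets with at
most `n` points. -/
def quantizationError (P : Measure E) (n : ℕ) : ℝ≥0∞ :=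
  ⨅ (α : Finset E) (_ : α.card ≤ n), distortion P α

/-- The quotient `2 log n / (- log V_n(P))`. -/
def dimensionRatio (P : Measure E) (n : ℕ) : ℝ :=
  2 * Real.log n / -Real.log (quantizationError P n).toReal

/-- The lower quantization dimension of `P`. -/
def lowerQuantizationDimension (P : Measure E) : EReal :=
  liminf (fun n : ℕ => (dimensionRatio P n : EReal)) atTop

/-- The upper quantization dimension of `P`. -/
def upperQuantizationDimension (P : Measure E) : EReal :=
  limsup (fun n : ℕ => (dimensionRatio P n : EReal)) atTop

/-- The quantization dimension of `P` exists and equals `D`. -/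
def HasQuantizationDimension (P : Measure E) (D : EReal) : Prop :=
  lowerQuantizationDimension P = D ∧ upperQuantizationDimension P = D

/-- The `s`-dimensional lower quantization coefficient `liminf n^(2/s) V_n(P)`. -/
def lowerQuantizationCoefficient (P : Measure E) (s : ℝ) : ℝ≥0∞ :=
  liminf (fun n : ℕ => (n : ℝ≥0∞) ^ (2 / s) * quantizationError P n) atTop

/-- The `s`-dimensional upper quantization coefficient `limsup n^(2/s) V_n(P)`. -/
def upperQuantizationCoefficient (P : Measure E) (s : ℝ) : ℝ≥0∞ :=
  limsup (fun n : ℕ => (n : ℝ≥0∞) ^ (2 / s) * quantizationError P n) atTop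

/-- The `s`-dimensional quantization coefficient of `P` exists (in `[0, ∞]`) and equals `c`: the
sequence `n^(2/s) V_n(P)` tends to `c`. -/
def HasQuantizationCoefficient (P : Measure E) (s : ℝ) (c : ℝ≥0∞) : Prop :=
  Tendsto (fun n : ℕ => (n : ℝ≥0∞) ^ (2 / s) * quantizationError P n) atTop (𝓝 c)

end General

/-- The similarities `S₁(x) = x/3` (index `0`) and `S₂(x) = x/3 + 1/3` (index `1`). -/
def S (i : Fin 2) (x : ℝ) : ℝ :=
  if i = 0 then x / 3 else x / 3 + 1 / 3

/-- `S_σ = S_{σ₁} ∘ ⋯ ∘ S_{σ_k}` for a word `σ = σ₁ ⋯ σ_k`; the empty word gives the identity. -/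
def wordMap : List (Fin 2) → ℝ → ℝ
  | [] => id
  | i :: σ => S i ∘ wordMap σ

/-- The Cantor set `C = ⋂_k ⋃_{|σ| = k} S_σ([0, 1/2])` generated by `S₁` and `S₂`. -/
def cantorC : Set ℝ :=
  ⋂ k : ℕ, ⋃ (σ : List (Fin 2)) (_ : σ.length = k), wordMap σ '' Set.Icc 0 (1 / 2)

/-- `P₁` is the Cantor distribution generated by `S₁` and `S₂` with weights `1/2`, `1/2`: a Borel
probability measure with `P₁ = ½ P₁ ∘ S₁⁻¹ + ½ P₁ ∘ S₂⁻¹`. -/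
structure IsCantorDistribution (P₁ : Measure ℝ) : Prop where
  isProbabilityMeasure : IsProbabilityMeasure P₁
  self_similar : P₁ = (2⁻¹ : ℝ≥0∞) • P₁.map (S 0) + (2⁻¹ : ℝ≥0∞) • P₁.map (S 1)

/-- The uniform distribution `P₂` on `D = {2/3, 5/6, 1}`. -/
def discreteD : Measure ℝ :=
  (3⁻¹ : ℝ≥0∞) • (Measure.dirac (2 / 3) + Measure.dirac (5 / 6) + Measure.dirac 1)

/-- The mixed distribution `P = ½ P₁ + ½ P₂`. -/
def mixedDistribution (P₁ : Measure ℝ) : Measure ℝ :=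
  (2⁻¹ : ℝ≥0∞) • P₁ + (2⁻¹ : ℝ≥0∞) • discreteD

/-! A Cantor distribution exists: the law of `∑ d_k(U) / 3 ^ (k + 1)`, where the `d_k(U)` are the
binary digits of a uniformly distributed `U` in `[0, 1)`. -/

/-- The `k`th binary digit of the fractional part of `x`. -/
def digit (k : ℕ) (x : ℝ) : ℝ := ((⌊2 ^ (k + 1) * x⌋ % 2 : ℤ) : ℝ)

/-- `∑ d_k(x) / 3 ^ (k + 1)`. -/
def coding (x : ℝ) : ℝ := ∑' k : ℕ, digit k x / 3 ^ (k + 1)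

/-- The law of `coding` under the uniform distribution on `[0, 1)`. -/
def cantorLaw : Measure ℝ := (volume.restrict (Set.Ico (0 : ℝ) 1)).map coding

lemma digit_mem (k : ℕ) (x : ℝ) : 0 ≤ digit k x ∧ digit k x ≤ 1 := by
  unfold digit
  have h1 := Int.emod_nonneg ⌊2 ^ (k + 1) * x⌋ (by norm_num : (2 : ℤ) ≠ 0)
  have h2 := Int.emod_lt_of_pos ⌊2 ^ (k + 1) * x⌋ (by norm_num : (0 : ℤ) < 2)
  constructor
  · exact_mod_cast h1
  · exact_mod_cast (by lia : ⌊2 ^ (k + 1) * x⌋ % 2 ≤ 1)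

lemma summable_digit (x : ℝ) : Summable fun k : ℕ => digit k x / 3 ^ (k + 1) := by
  have hg : Summable fun k : ℕ => (1 / 3 : ℝ) ^ k :=
    summable_geometric_of_lt_one (by norm_num) (by norm_num)
  refine Summable.of_nonneg_of_le (fun k => div_nonneg (digit_mem k x).1 (by positivity))
    (fun k => ?_) hg
  rw [one_div, inv_pow, ← one_div]
  exact div_le_div₀ zero_le_one (digit_mem k x).2 (by positivity)
    (pow_le_pow_right₀ (by norm_num) (Nat.le_succ k))

lemma measurable_coding : Measurable coding := by
  have hm : ∀ k : ℕ, Measurable fun x : ℝ => digit k x / 3 ^ (k + 1) := by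
    intro k
    have h1 : Measurable fun x : ℝ => ⌊2 ^ (k + 1) * x⌋ := Int.measurable_floor.comp (by fun_prop)
    have h2 : Measurable fun m : ℤ => ((m % 2 : ℤ) : ℝ) := measurable_from_top
    exact (h2.comp h1).div_const _
  refine measurable_of_tendsto_metrizable
    (fun n => Finset.measurable_fun_sum (Finset.range n) fun k _ => hm k) ?_
  rw [tendsto_pi_nhds]
  exact fun x => (summable_digit x).hasSum.tendsto_sum_nat

lemma measurable_S (i : Fin 2) : Measurable (S i) := by
  unfold S
  split_ifs <;> fun_prop

lemma coding_shift (i : ℤ) (hi : i = 0 ∨ i = 1) {x : ℝ} (hx : x ∈ Set.Ico (0 : ℝ) 1) :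
    coding (x / 2 + i / 2) = coding x / 3 + i / 3 := by
  have h0 : digit 0 (x / 2 + i / 2) = i := by
    unfold digit
    have : (2 : ℝ) ^ (0 + 1) * (x / 2 + i / 2) = x + i := by ring
    rw [this, Int.floor_add_intCast, Int.floor_eq_zero_iff.2 hx]
    rcases hi with rfl | rfl <;> norm_num
  have hs : ∀ k, digit (k + 1) (x / 2 + i / 2) = digit k x := by
    intro k
    unfold digit
    have : (2 : ℝ) ^ (k + 1 + 1) * (x / 2 + i / 2)
        = 2 ^ (k + 1) * x + ((2 * (2 ^ k * i) : ℤ) : ℝ) := by push_cast; ring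
    rw [this, Int.floor_add_intCast, Int.add_mul_emod_self_left]
  unfold coding
  rw [(summable_digit _).tsum_eq_zero_add, h0]
  have : ∀ k : ℕ, digit (k + 1) (x / 2 + i / 2) / 3 ^ (k + 1 + 1)
      = digit k x / 3 ^ (k + 1) / 3 := by
    intro k
    rw [hs, pow_succ (3 : ℝ) (k + 1), div_mul_eq_div_div]
  simp_rw [this]
  rw [tsum_div_const]
  norm_num
  ring

lemma volume_half (i : ℤ) (hi : i = 0 ∨ i = 1) (s : Set ℝ) :
    volume (coding ⁻¹' s ∩ Set.Ico ((i : ℝ) / 2) ((i : ℝ) / 2 + 1 / 2))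
      = 2⁻¹ * volume ((fun x => coding x / 3 + i / 3) ⁻¹' s ∩ Set.Ico (0 : ℝ) 1) := by
  have h1 : (fun x : ℝ => 2 * x) ⁻¹' ((fun y : ℝ => y + -(i : ℝ)) ⁻¹'
      ((fun x => coding x / 3 + i / 3) ⁻¹' s ∩ Set.Ico (0 : ℝ) 1))
      = coding ⁻¹' s ∩ Set.Ico ((i : ℝ) / 2) ((i : ℝ) / 2 + 1 / 2) := by
    ext x
    simp only [Set.mem_preimage, Set.mem_inter_iff, Set.mem_Ico]
    have hiff : (0 ≤ 2 * x + -(i : ℝ) ∧ 2 * x + -(i : ℝ) < 1) ↔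
        ((i : ℝ) / 2 ≤ x ∧ x < (i : ℝ) / 2 + 1 / 2) := by
      constructor <;> rintro ⟨h, h'⟩ <;> constructor <;> linarith
    rw [← hiff]
    refine and_congr_left fun h => ?_
    rw [← coding_shift i hi h]
    have : (2 * x + -(i : ℝ)) / 2 + i / 2 = x := by ring
    rw [this]
  rw [← h1, Real.volume_preimage_mul_left (by norm_num), measure_preimage_add_right]
  congr 1
  rw [abs_of_pos (by norm_num), ENNReal.ofReal_inv_of_pos (by norm_num)]
  norm_num

/-- The Cantor distribution exists. -/
theorem isCantorDistribution_cantorLaw : IsCantorDistribution cantorLaw where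
  isProbabilityMeasure := by
    have : IsProbabilityMeasure (volume.restrict (Set.Ico (0 : ℝ) 1)) := ⟨by simp⟩
    exact Measure.isProbabilityMeasure_map measurable_coding.aemeasurable
  self_similar := by
    have hmap : ∀ i s, MeasurableSet s → cantorLaw.map (S i) s
        = volume ((fun x => S i (coding x)) ⁻¹' s ∩ Set.Ico (0 : ℝ) 1) := by
      intro i s hs
      rw [Measure.map_apply (measurable_S i) hs, cantorLaw,
        Measure.map_apply measurable_coding (measurable_S i hs),
        Measure.restrict_apply (measurable_coding (measurable_S i hs))]
      rfl
    ext s hs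
    rw [Measure.add_apply, Measure.smul_apply, Measure.smul_apply, hmap 0 s hs, hmap 1 s hs,
      cantorLaw, Measure.map_apply measurable_coding hs,
      Measure.restrict_apply (measurable_coding hs)]
    have h0 := volume_half 0 (Or.inl rfl) s
    have h1 := volume_half 1 (Or.inr rfl) s
    have hS0 : (fun x => S 0 (coding x)) = fun x => coding x / 3 + ((0 : ℤ) : ℝ) / 3 := by
      funext x; simp [S]
    have hS1 : (fun x => S 1 (coding x)) = fun x => coding x / 3 + ((1 : ℤ) : ℝ) / 3 := by
      funext x; simp [S]
    rw [hS0, hS1, smul_eq_mul, smul_eq_mul, ← h0, ← h1,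
      ← measure_union ?_ ((measurable_coding hs).inter measurableSet_Ico),
      ← Set.inter_union_distrib_left]
    · congr 2
      have : Set.Ico (((0 : ℤ) : ℝ) / 2) (((0 : ℤ) : ℝ) / 2 + 1 / 2) ∪
          Set.Ico (((1 : ℤ) : ℝ) / 2) (((1 : ℤ) : ℝ) / 2 + 1 / 2) = Set.Ico (0 : ℝ) 1 := by
        norm_num
      exact this.symm
    · rw [Set.disjoint_left]
      rintro x ⟨-, hx⟩ ⟨-, hx'⟩
      simp only [Set.mem_Ico] at hx hx'
      norm_num at hx hx'
      linarith [hx.2, hx'.1]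

end

end Quantization

/-! Write `V_n` for the quantization errors of `P₁` and `β = log 2 / log 3`. Everything rests on
self-similarity: the distortion of `α` is `1/18` times the sum of the distortions of `3α` and `3α -
1` (`distortion_eq`).

Upper bounds: copying a set into both halves gives `V_{2n} ≤ V_n / 9`. Since `P₁` has mean `1/4` and
variance `1/32`, it follows that `V_{2^k} ≤ 1 / (32 * 9^k)`.

Lower bounds: add to every set two "walls", `-1/4` and `3/4`. With walls the halves decouple: points
up to `1/4` serve only the left half, the others only the right half (`le_distortion_withWalls`). A
lower bound `c (4 - card α)`, affine in the cardinality, then passes to the next level with `c`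
divided by `9` and the cardinality halved (`le_distortion_withWalls_pow`). As `2^(2/β) = 9`, the
sequence `n^(2/β) V_n` stays between positive constants, which forces the dimension `β`.

The sequence has no limit: it is at most `1/32` along `n = 2^k` and at least `3^(2/β) * 5/5184`
along `n = 3 * 2^k`, which is larger because `3^(2/β) > 162/5`.

For the mixture, three extra points absorb the atoms, so `V_n / 2 ≤ V_n(P)` and `V_{n+3}(P) ≤ V_n /
2`. The shift by three changes `n^(2/β)` by a factor tending to `1`, so all asymptotic statements
transfer.

The Hausdorff dimension comes from the cover by the `2^k` basic intervals and from the mass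
distribution principle for `P₁`. -/

namespace Quantization

/-! ### Distortion and quantization error of general measures -/

section General

variable {P : Measure ℝ}

lemma measurable_iInf_enorm_sub (α : Finset ℝ) :
    Measurable fun x : ℝ => ⨅ a ∈ α, ‖x - a‖ₑ ^ 2 :=
  Measurable.biInf (α : Set ℝ) α.countable_toSet fun a _ => by fun_prop

lemma enorm_sub_sq (x a : ℝ) : ‖x - a‖ₑ ^ 2 = ENNReal.ofReal ((x - a) ^ 2) := by
  rw [Real.enorm_eq_ofReal_abs, ← ENNReal.ofReal_pow (abs_nonneg _), sq_abs]

/-- If almost every point is at least as close to `β` as to `α`, then the distortion of `β` is at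
most that of `α`. -/
lemma distortion_le_of_dominates {s : Set ℝ} (hs : ∀ᵐ x ∂P, x ∈ s) {α β : Finset ℝ}
    (h : ∀ x ∈ s, ∀ a ∈ α, ∃ b ∈ β, |x - b| ≤ |x - a|) :
    distortion P β ≤ distortion P α := by
  refine lintegral_mono_ae ?_
  filter_upwards [hs] with x hx
  refine le_iInf₂ fun a ha => ?_
  obtain ⟨b, hb, hab⟩ := h x hx a ha
  refine (iInf₂_le b hb).trans ?_
  rw [enorm_sub_sq, enorm_sub_sq]
  exact ENNReal.ofReal_le_ofReal (sq_le_sq.2 hab)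

lemma distortion_anti {α β : Finset ℝ} (h : α ⊆ β) : distortion P β ≤ distortion P α :=
  lintegral_mono fun _ => biInf_mono fun _ ha => h ha

lemma quantizationError_le (α : Finset ℝ) {n : ℕ} (h : α.card ≤ n) :
    quantizationError P n ≤ distortion P α :=
  iInf₂_le α h

lemma quantizationError_anti {m n : ℕ} (h : m ≤ n) :
    quantizationError P n ≤ quantizationError P m :=
  le_iInf₂ fun α hα => quantizationError_le α (hα.trans h)

end General

/-! ### Support, moments and self-similarity of the Cantor distribution -/

/-- The intervals `[-r, 1/2 + r]` absorb their preimages under the two similarities. -/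
lemma S_mem_Icc_of_mem {r x : ℝ} (hx : x ∈ Set.Icc (-(3 * r)) (1 / 2 + 3 * r))
    (i : Fin 2) : S i x ∈ Set.Icc (-r) (1 / 2 + r) := by
  obtain ⟨h1, h2⟩ := hx
  unfold S
  split_ifs <;> constructor <;> linarith

lemma S_apply_zero (x : ℝ) : S 0 x = x / 3 := by simp [S]

lemma S_apply_one (x : ℝ) : S 1 x = x / 3 + 1 / 3 := by simp [S]

namespace IsCantorDistribution

variable {P₁ : Measure ℝ}

lemma measure_eq (h : IsCantorDistribution P₁) {s : Set ℝ} (hs : MeasurableSet s) :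
    P₁ s = 2⁻¹ * P₁ (S 0 ⁻¹' s) + 2⁻¹ * P₁ (S 1 ⁻¹' s) := by
  conv_lhs => rw [h.self_similar]
  rw [Measure.add_apply, Measure.smul_apply, Measure.smul_apply,
    Measure.map_apply (measurable_S 0) hs, Measure.map_apply (measurable_S 1) hs, smul_eq_mul,
    smul_eq_mul]

lemma lintegral_eq (h : IsCantorDistribution P₁) {f : ℝ → ℝ≥0∞} (hf : Measurable f) :
    ∫⁻ x, f x ∂P₁ = 2⁻¹ * ∫⁻ x, f (S 0 x) ∂P₁ + 2⁻¹ * ∫⁻ x, f (S 1 x) ∂P₁ := by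
  conv_lhs => rw [h.self_similar]
  rw [lintegral_add_measure, lintegral_smul_measure, lintegral_smul_measure,
    lintegral_map hf (measurable_S 0), lintegral_map hf (measurable_S 1), smul_eq_mul, smul_eq_mul]

lemma measure_of_subset_preimage (h : IsCantorDistribution P₁) {s t : Set ℝ}
    (hs : MeasurableSet s) (ht : ∀ i, t ⊆ S i ⁻¹' s) : P₁ t ≤ P₁ s := by
  rw [h.measure_eq hs, ← mul_add, ← one_mul (P₁ t)]
  calc 1 * P₁ t = 2⁻¹ * (P₁ t + P₁ t) := by
        rw [← two_mul, ← mul_assoc, ENNReal.inv_mul_cancel (by norm_num) (by norm_num)]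
    _ ≤ _ := by gcongr <;> exact ht _

/-- Tripling the margin `r` does not increase the mass, by self-similarity, while the enlarged
intervals exhaust the line. -/
lemma measure_Icc_enlarged (h : IsCantorDistribution P₁) {r : ℝ} (hr : 0 < r) :
    P₁ (Set.Icc (-r) (1 / 2 + r)) = 1 := by
  have := h.isProbabilityMeasure
  refine le_antisymm prob_le_one ?_
  have hk : ∀ k : ℕ, P₁ (Set.Icc (-(3 ^ k * r)) (1 / 2 + 3 ^ k * r))
      ≤ P₁ (Set.Icc (-r) (1 / 2 + r)) := by
    intro k
    induction k with
    | zero => simp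
    | succ k ih =>
      refine le_trans (h.measure_of_subset_preimage measurableSet_Icc fun i x hx => ?_) ih
      refine S_mem_Icc_of_mem ?_ i
      convert hx using 2 <;> ring
  have hmono : Monotone fun k : ℕ => Set.Icc (-(3 ^ k * r)) (1 / 2 + 3 ^ k * r) := by
    intro k l hkl
    have : (3 : ℝ) ^ k * r ≤ 3 ^ l * r := by gcongr; norm_num
    exact Set.Icc_subset_Icc (by linarith) (by linarith)
  have hun : ⋃ k : ℕ, Set.Icc (-(3 ^ k * r)) (1 / 2 + 3 ^ k * r) = Set.univ := by
    refine Set.eq_univ_of_forall fun x => Set.mem_iUnion.2 ?_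
    obtain ⟨k, hk⟩ := pow_unbounded_of_one_lt (|x| / r) (by norm_num : (1 : ℝ) < 3)
    rw [div_lt_iff₀ hr, abs_lt] at hk
    exact ⟨k, by linarith [hk.1], by linarith [hk.2]⟩
  have hlim := tendsto_measure_iUnion_atTop (μ := P₁) hmono
  rw [hun, measure_univ] at hlim
  exact le_of_tendsto' hlim hk

lemma ae_mem_Icc (h : IsCantorDistribution P₁) : ∀ᵐ x ∂P₁, x ∈ Set.Icc (0 : ℝ) (1 / 2) := by
  have := h.isProbabilityMeasure
  have h1 : ∀ᵐ x ∂P₁, ∀ n : ℕ, x ∈ Set.Icc (-(1 / ((n : ℝ) + 1))) (1 / 2 + 1 / ((n : ℝ) + 1)) := by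
    rw [ae_all_iff]
    intro n
    exact (prob_compl_eq_zero_iff measurableSet_Icc).2 (h.measure_Icc_enlarged (by positivity))
  filter_upwards [h1] with x hx
  have h0 := tendsto_one_div_add_atTop_nhds_zero_nat (𝕜 := ℝ)
  constructor
  · refine le_of_tendsto' (by simpa using h0.neg) fun n => (hx n).1
  · have h1 := h0.const_add (1 / 2)
    rw [add_zero] at h1
    exact ge_of_tendsto' h1 fun n => (hx n).2

lemma integrable (h : IsCantorDistribution P₁) {f : ℝ → ℝ} (hf : Continuous f) :
    Integrable f P₁ := by
  have := h.isProbabilityMeasure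
  obtain ⟨C, hC⟩ := isCompact_Icc.exists_bound_of_continuousOn (s := Set.Icc (0 : ℝ) (1 / 2))
    hf.continuousOn
  refine Integrable.of_bound hf.aestronglyMeasurable C ?_
  filter_upwards [h.ae_mem_Icc] with x hx using hC x hx

lemma integral_eq (h : IsCantorDistribution P₁) {f : ℝ → ℝ} (hf : Continuous f) :
    ∫ x, f x ∂P₁ = 2⁻¹ * ∫ x, f (x / 3) ∂P₁ + 2⁻¹ * ∫ x, f (x / 3 + 1 / 3) ∂P₁ := by
  have hi : ∀ i, Integrable f ((2⁻¹ : ℝ≥0∞) • P₁.map (S i)) := by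
    intro i
    refine (Integrable.smul_measure ?_ (by norm_num))
    rw [integrable_map_measure hf.aestronglyMeasurable (measurable_S i).aemeasurable]
    refine h.integrable (hf.comp ?_)
    unfold S
    split_ifs <;> fun_prop
  conv_lhs => rw [h.self_similar]
  rw [integral_add_measure (hi 0) (hi 1), integral_smul_measure, integral_smul_measure,
    integral_map (measurable_S 0).aemeasurable hf.aestronglyMeasurable,
    integral_map (measurable_S 1).aemeasurable hf.aestronglyMeasurable]
  simp [S_apply_zero, S_apply_one]

lemma integral_quadratic (h : IsCantorDistribution P₁) (c d e : ℝ) :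
    ∫ x, (c * x ^ 2 + d * x + e) ∂P₁ = c * ∫ x, x ^ 2 ∂P₁ + d * ∫ x, x ∂P₁ + e := by
  have := h.isProbabilityMeasure
  rw [integral_add (h.integrable (by fun_prop)) (integrable_const e),
    integral_add (h.integrable (by fun_prop)) (h.integrable (by fun_prop)), integral_const_mul,
    integral_const_mul]
  simp

/-- Self-similarity turns the mean `m` into a solution of `m = m/3 + 1/6`; the second moment is
found in the same way. -/
lemma integral_id (h : IsCantorDistribution P₁) : ∫ x, x ∂P₁ = 1 / 4 := by
  have e := h.integral_eq (f := fun x => x) continuous_id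
  have e0 : ∫ x, x / 3 ∂P₁ = ∫ x, (0 * x ^ 2 + 1 / 3 * x + 0) ∂P₁ := by
    congr 1; funext x; ring
  have e1 : ∫ x, (x / 3 + 1 / 3) ∂P₁ = ∫ x, (0 * x ^ 2 + 1 / 3 * x + 1 / 3) ∂P₁ := by
    congr 1; funext x; ring
  rw [e0, e1, h.integral_quadratic, h.integral_quadratic] at e
  linarith

lemma integral_sq (h : IsCantorDistribution P₁) : ∫ x, x ^ 2 ∂P₁ = 3 / 32 := by
  have e := h.integral_eq (f := fun x => x ^ 2) (by fun_prop)
  have e0 : ∫ x, (x / 3) ^ 2 ∂P₁ = ∫ x, (1 / 9 * x ^ 2 + 0 * x + 0) ∂P₁ := by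
    congr 1; funext x; ring
  have e1 : ∫ x, (x / 3 + 1 / 3) ^ 2 ∂P₁ = ∫ x, (1 / 9 * x ^ 2 + 2 / 9 * x + 1 / 9) ∂P₁ := by
    congr 1; funext x; ring
  rw [e0, e1, h.integral_quadratic, h.integral_quadratic, h.integral_id] at e
  linarith

lemma integral_sub_sq (h : IsCantorDistribution P₁) (a : ℝ) :
    ∫ x, (x - a) ^ 2 ∂P₁ = 1 / 32 + (a - 1 / 4) ^ 2 := by
  have e : ∫ x, (x - a) ^ 2 ∂P₁ = ∫ x, (1 * x ^ 2 + (-2 * a) * x + a ^ 2) ∂P₁ := by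
    congr 1; funext x; ring
  rw [e, h.integral_quadratic, h.integral_id, h.integral_sq]
  ring

lemma distortion_singleton (h : IsCantorDistribution P₁) (a : ℝ) :
    distortion P₁ {a} = ENNReal.ofReal (1 / 32 + (a - 1 / 4) ^ 2) := by
  rw [← h.integral_sub_sq, ofReal_integral_eq_lintegral_ofReal (h.integrable (by fun_prop))
    (.of_forall fun x => sq_nonneg _)]
  simp only [distortion, Finset.mem_singleton, iInf_iInf_eq_left, enorm_sub_sq]

/-- The distortion of a set is the mean of the distortions of its preimages under the two
similarities, scaled by the square of the contraction ratio. -/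
lemma distortion_eq (h : IsCantorDistribution P₁) (α : Finset ℝ) :
    distortion P₁ α = ENNReal.ofReal (1 / 18) *
      (distortion P₁ (α.image fun a => 3 * a) + distortion P₁ (α.image fun a => 3 * a - 1)) := by
  have key : ∀ x c : ℝ, ⨅ a ∈ α, ‖x / 3 + c / 3 - a‖ₑ ^ 2
      = ENNReal.ofReal (1 / 9) * ⨅ a ∈ α.image fun a => 3 * a - c, ‖x - a‖ₑ ^ 2 := by
    intro x c
    have h0 : ENNReal.ofReal (1 / 9) ≠ 0 := by norm_num
    rw [Finset.iInf_finset_image, ENNReal.mul_iInf_of_ne h0 ENNReal.ofReal_ne_top]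
    refine iInf_congr fun a => ?_
    rw [ENNReal.mul_iInf_of_ne h0 ENNReal.ofReal_ne_top]
    refine iInf_congr fun _ => ?_
    rw [enorm_sub_sq, enorm_sub_sq, ← ENNReal.ofReal_mul (by norm_num)]
    congr 1
    ring
  have k0 : ∀ x, ⨅ a ∈ α, ‖S 0 x - a‖ₑ ^ 2
      = ENNReal.ofReal (1 / 9) * ⨅ a ∈ α.image fun a => 3 * a, ‖x - a‖ₑ ^ 2 := by
    intro x
    simpa [S_apply_zero] using key x 0
  have k1 : ∀ x, ⨅ a ∈ α, ‖S 1 x - a‖ₑ ^ 2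
      = ENNReal.ofReal (1 / 9) * ⨅ a ∈ α.image fun a => 3 * a - 1, ‖x - a‖ₑ ^ 2 := by
    intro x
    rw [S_apply_one]
    exact key x 1
  have h2 : ENNReal.ofReal (1 / 18) = 2⁻¹ * ENNReal.ofReal (1 / 9) := by
    rw [← ENNReal.ofReal_ofNat 2, ← ENNReal.ofReal_inv_of_pos (by norm_num),
      ← ENNReal.ofReal_mul (by norm_num)]
    norm_num
  unfold distortion
  rw [h.lintegral_eq (measurable_iInf_enorm_sub α)]
  simp_rw [k0, k1]
  rw [lintegral_const_mul _ (measurable_iInf_enorm_sub _),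
    lintegral_const_mul _ (measurable_iInf_enorm_sub _), ← mul_assoc, ← mul_assoc, ← mul_add, h2]

end IsCantorDistribution

/-! ### Error bounds at dyadic scales -/

/-- `α` enlarged by the two points `-1/4` and `3/4`, which separate the support of the Cantor
distribution from whatever lies outside. -/
noncomputable def withWalls (α : Finset ℝ) : Finset ℝ := insert (-(1 / 4)) (insert (3 / 4) α)

lemma mem_withWalls {α : Finset ℝ} {a : ℝ} :
    a ∈ withWalls α ↔ a = -(1 / 4) ∨ a = 3 / 4 ∨ a ∈ α := by
  simp [withWalls]

namespace IsCantorDistribution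

variable {P₁ : Measure ℝ}

lemma quantizationError_two_mul_le (h : IsCantorDistribution P₁) (n : ℕ) :
    quantizationError P₁ (2 * n) ≤ ENNReal.ofReal (1 / 9) * quantizationError P₁ n := by
  have h0 : ENNReal.ofReal (1 / 9) ≠ 0 := by norm_num
  unfold quantizationError
  rw [ENNReal.mul_iInf_of_ne h0 ENNReal.ofReal_ne_top]
  refine le_iInf fun β => ?_
  rw [ENNReal.mul_iInf_of_ne h0 ENNReal.ofReal_ne_top]
  refine le_iInf fun hβ => ?_
  set α : Finset ℝ := (β.image fun b => b / 3) ∪ β.image fun b => (b + 1) / 3 with hα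
  have hcard : α.card ≤ 2 * n := by
    refine (Finset.card_union_le _ _).trans ?_
    have h1 := Finset.card_image_le (s := β) (f := fun b => b / 3)
    have h2 := Finset.card_image_le (s := β) (f := fun b => (b + 1) / 3)
    lia
  refine (iInf₂_le α hcard).trans ?_
  rw [h.distortion_eq α]
  have s0 : β ⊆ α.image fun a => 3 * a := fun b hb => Finset.mem_image.2
    ⟨b / 3, Finset.mem_union_left _ (Finset.mem_image_of_mem _ hb), by ring⟩
  have s1 : β ⊆ α.image fun a => 3 * a - 1 := fun b hb => Finset.mem_image.2
    ⟨(b + 1) / 3, Finset.mem_union_right _ (Finset.mem_image_of_mem (fun b => (b + 1) / 3) hb),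
      by ring⟩
  calc _ ≤ ENNReal.ofReal (1 / 18) * (distortion P₁ β + distortion P₁ β) := by
        gcongr
        · exact distortion_anti s0
        · exact distortion_anti s1
    _ = ENNReal.ofReal (1 / 9) * distortion P₁ β := by
        rw [← two_mul, ← mul_assoc, ← ENNReal.ofReal_ofNat 2, ← ENNReal.ofReal_mul (by norm_num)]
        norm_num

lemma quantizationError_two_pow_le (h : IsCantorDistribution P₁) (k : ℕ) :
    quantizationError P₁ (2 ^ k) ≤ ENNReal.ofReal (1 / 32 / 9 ^ k) := by
  induction k with
  | zero =>
    refine (quantizationError_le {1 / 4} (by simp)).trans ?_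
    rw [h.distortion_singleton]
    norm_num
  | succ k ih =>
    rw [pow_succ']
    refine (h.quantizationError_two_mul_le _).trans ((mul_le_mul_right ih _).trans ?_)
    rw [← ENNReal.ofReal_mul (by norm_num)]
    refine ENNReal.ofReal_le_ofReal (le_of_eq ?_)
    rw [pow_succ]
    field_simp

lemma mul_add_ofReal_le {x y : ℝ} {u v : ℝ≥0∞} (hu : ENNReal.ofReal x ≤ u)
    (hv : ENNReal.ofReal y ≤ v) :
    ENNReal.ofReal (1 / 18 * (x + y)) ≤ ENNReal.ofReal (1 / 18) * (u + v) := by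
  rw [ENNReal.ofReal_mul (by norm_num)]
  gcongr
  exact ENNReal.ofReal_add_le.trans (add_le_add hu hv)

/-- Splitting `α` at `1/4`, the distortion with walls dominates the scaled mean of those of the
two parts. -/
lemma le_distortion_withWalls (h : IsCantorDistribution P₁) (α : Finset ℝ) :
    ∃ β γ : Finset ℝ, β.card + γ.card = α.card ∧
      ENNReal.ofReal (1 / 18) * (distortion P₁ (withWalls β) + distortion P₁ (withWalls γ))
        ≤ distortion P₁ (withWalls α) := by
  refine ⟨(α.filter (· ≤ 1 / 4)).image fun a => 3 * a,
    (α.filter (¬ · ≤ 1 / 4)).image fun a => 3 * a - 1, ?_, ?_⟩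
  · rw [Finset.card_image_of_injective _ fun a b hab => by simpa using hab,
      Finset.card_image_of_injective _ fun a b hab => by simpa using hab,
      Finset.card_filter_add_card_filter_not]
  · rw [h.distortion_eq (withWalls α)]
    gcongr
    · refine distortion_le_of_dominates h.ae_mem_Icc fun x hx a ha => ?_
      obtain ⟨hx0, hx1⟩ := hx
      obtain ⟨b, hb, rfl⟩ := Finset.mem_image.1 ha
      -- The old walls are mapped outside `[-1/4, 3/4]`, and a point `b > 1/4` is mapped beyond
      -- `3/4`. In each case a new wall lies between the image and the support.
      rcases mem_withWalls.1 hb with rfl | rfl | hb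
      · refine ⟨-(1 / 4), mem_withWalls.2 (.inl rfl), ?_⟩
        rw [abs_of_nonneg (by linarith), abs_of_nonneg (by linarith)]
        linarith
      · refine ⟨3 / 4, mem_withWalls.2 (.inr (.inl rfl)), ?_⟩
        rw [abs_of_nonpos (by linarith), abs_of_nonpos (by linarith)]
        linarith
      · by_cases hb4 : b ≤ 1 / 4
        · exact ⟨3 * b, mem_withWalls.2 (.inr (.inr (Finset.mem_image.2
            ⟨b, Finset.mem_filter.2 ⟨hb, hb4⟩, rfl⟩))), le_rfl⟩
        · refine ⟨3 / 4, mem_withWalls.2 (.inr (.inl rfl)), ?_⟩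
          rw [abs_of_nonpos (by linarith), abs_of_nonpos (by linarith)]
          linarith
    · refine distortion_le_of_dominates h.ae_mem_Icc fun x hx a ha => ?_
      obtain ⟨hx0, hx1⟩ := hx
      obtain ⟨b, hb, rfl⟩ := Finset.mem_image.1 ha
      rcases mem_withWalls.1 hb with rfl | rfl | hb
      · refine ⟨-(1 / 4), mem_withWalls.2 (.inl rfl), ?_⟩
        rw [abs_of_nonneg (by linarith), abs_of_nonneg (by linarith)]
        linarith
      · refine ⟨3 / 4, mem_withWalls.2 (.inr (.inl rfl)), ?_⟩
        rw [abs_of_nonpos (by linarith), abs_of_nonpos (by linarith)]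
        linarith
      · by_cases hb4 : b ≤ 1 / 4
        · refine ⟨-(1 / 4), mem_withWalls.2 (.inl rfl), ?_⟩
          rw [abs_of_nonneg (by linarith), abs_of_nonneg (by linarith)]
          linarith
        · exact ⟨3 * b - 1, mem_withWalls.2 (.inr (.inr (Finset.mem_image.2
            ⟨b, Finset.mem_filter.2 ⟨hb, hb4⟩, rfl⟩))), le_rfl⟩

/-- A single point bounds the distortion of `α` from below if it is nearer to the support than
all points of `α`. -/
lemma le_distortion_of_point (h : IsCantorDistribution P₁) {α : Finset ℝ} (b : ℝ) {v : ℝ}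
    (hv : v ≤ 1 / 32 + (b - 1 / 4) ^ 2)
    (hb : ∀ x : ℝ, 0 ≤ x → x ≤ 1 / 2 → ∀ a ∈ α, |x - b| ≤ |x - a|) :
    ENNReal.ofReal v ≤ distortion P₁ α := by
  refine (ENNReal.ofReal_le_ofReal hv).trans ?_
  rw [← h.distortion_singleton b]
  exact distortion_le_of_dominates h.ae_mem_Icc fun x hx a ha =>
    ⟨b, Finset.mem_singleton_self b, hb x hx.1 hx.2 a ha⟩

/-- The estimates would give `33/288`; `5/144` is what the two-point case of
`le_distortion_withWalls_of_card` uses. -/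
lemma le_distortion_withWalls_empty (h : IsCantorDistribution P₁) :
    ENNReal.ofReal (5 / 144) ≤ distortion P₁ (withWalls ∅) := by
  rw [h.distortion_eq]
  refine le_trans (ENNReal.ofReal_le_ofReal ?_) (mul_add_ofReal_le
    (h.le_distortion_of_point (-(3 / 4)) le_rfl ?_) (h.le_distortion_of_point (5 / 4) le_rfl ?_))
  · norm_num
  · intro x hx0 hx1 a ha
    obtain ⟨b, hb, rfl⟩ := Finset.mem_image.1 ha
    rcases mem_withWalls.1 hb with rfl | rfl | hb
    · norm_num
    · rw [abs_of_nonneg (by linarith), abs_of_nonpos (by linarith)]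
      linarith
    · simp at hb
  · intro x hx0 hx1 a ha
    obtain ⟨b, hb, rfl⟩ := Finset.mem_image.1 ha
    rcases mem_withWalls.1 hb with rfl | rfl | hb
    · rw [abs_of_nonpos (by linarith), abs_of_nonneg (by linarith)]
      linarith
    · norm_num
    · simp at hb

/-- The half holding `a` costs at least the variance `1/32`. For the other half, no image is nearer
than a point at distance `1/2` from the mean, which costs `1/32 + 1/4`. Together, `1/18 * 10/32 =
5/288`. -/
lemma le_distortion_withWalls_singleton (h : IsCantorDistribution P₁) (a : ℝ) :
    ENNReal.ofReal (5 / 288) ≤ distortion P₁ (withWalls {a}) := by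
  rw [h.distortion_eq]
  rcases le_or_gt a (1 / 4) with ha | ha
  · refine le_trans (ENNReal.ofReal_le_ofReal ?_) (mul_add_ofReal_le
      -- The image of `a`, clamped at the image `-3/4` of the left wall, is the nearest competitor.
      (h.le_distortion_of_point (v := 1 / 32) (max (3 * a) (-(3 / 4))) ?_ ?_)
      (h.le_distortion_of_point (-(1 / 4)) le_rfl ?_))
    · norm_num
    · nlinarith [sq_nonneg (max (3 * a) (-(3 / 4)) - 1 / 4)]
    · intro x hx0 hx1 c hc
      obtain ⟨b, hb, rfl⟩ := Finset.mem_image.1 hc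
      have hm0 := le_max_left (3 * a) (-(3 / 4))
      have hm1 := le_max_right (3 * a) (-(3 / 4))
      have hm2 : max (3 * a) (-(3 / 4)) ≤ 3 / 4 := max_le (by linarith) (by norm_num)
      rcases mem_withWalls.1 hb with rfl | rfl | hb
      · rw [abs_of_nonneg (a := x - 3 * -(1 / 4)) (by linarith), abs_le]
        constructor <;> linarith
      · rw [abs_of_nonpos (a := x - 3 * (3 / 4)) (by linarith), abs_le]
        constructor <;> linarith
      · rw [Finset.mem_singleton.1 hb]
        rcases le_or_gt (-(3 / 4)) (3 * a) with ha' | ha'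
        · rw [max_eq_left ha']
        · rw [max_eq_right ha'.le, abs_of_nonneg (by linarith), abs_of_nonneg (by linarith)]
          linarith
    · intro x hx0 hx1 c hc
      obtain ⟨b, hb, rfl⟩ := Finset.mem_image.1 hc
      rw [abs_of_nonneg (by linarith)]
      rcases mem_withWalls.1 hb with rfl | rfl | hb
      · rw [abs_of_nonneg (by linarith)]
        linarith
      · rw [abs_of_nonpos (by linarith)]
        linarith
      · rw [Finset.mem_singleton.1 hb, abs_of_nonneg (by linarith)]
        linarith
  · refine le_trans (ENNReal.ofReal_le_ofReal ?_) (mul_add_ofReal_le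
      (h.le_distortion_of_point (3 / 4) le_rfl ?_)
      (h.le_distortion_of_point (v := 1 / 32) (min (3 * a - 1) (5 / 4)) ?_ ?_))
    · norm_num
    · intro x hx0 hx1 c hc
      obtain ⟨b, hb, rfl⟩ := Finset.mem_image.1 hc
      rw [abs_of_nonpos (by linarith)]
      rcases mem_withWalls.1 hb with rfl | rfl | hb
      · rw [abs_of_nonneg (by linarith)]
        linarith
      · rw [abs_of_nonpos (by linarith)]
        linarith
      · rw [Finset.mem_singleton.1 hb, abs_of_nonpos (by linarith)]
        linarith
    · nlinarith [sq_nonneg (min (3 * a - 1) (5 / 4) - 1 / 4)]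
    · intro x hx0 hx1 c hc
      obtain ⟨b, hb, rfl⟩ := Finset.mem_image.1 hc
      have hm0 := min_le_left (3 * a - 1) (5 / 4)
      have hm1 := min_le_right (3 * a - 1) (5 / 4)
      have hm2 : -(1 / 4) ≤ min (3 * a - 1) (5 / 4) := le_min (by linarith) (by norm_num)
      rcases mem_withWalls.1 hb with rfl | rfl | hb
      · rw [abs_of_nonneg (a := x - (3 * -(1 / 4) - 1)) (by linarith), abs_le]
        constructor <;> linarith
      · rw [abs_of_nonpos (a := x - (3 * (3 / 4) - 1)) (by linarith), abs_le]
        constructor <;> linarith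
      · rw [Finset.mem_singleton.1 hb]
        rcases le_or_gt (3 * a - 1) (5 / 4) with ha' | ha'
        · rw [min_eq_left ha']
        · rw [min_eq_right ha'.le, abs_of_nonpos (by linarith), abs_of_nonpos (by linarith)]
          linarith

lemma le_distortion_withWalls_of_card_le_one (h : IsCantorDistribution P₁) {α : Finset ℝ}
    (hα : α.card ≤ 1) :
    ENNReal.ofReal (5 / 288) ≤ distortion P₁ (withWalls α) := by
  rcases Finset.card_le_one_iff_subset_singleton.1 hα with ⟨a, ha⟩
  refine (h.le_distortion_withWalls_singleton a).trans (distortion_anti ?_)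
  exact Finset.insert_subset_insert _ (Finset.insert_subset_insert _ ha)

/-- The affine bound is tuned to cardinalities two and three: a split `1 + 1` yields `1/18 * 2 *
5/288 = 2 * 5/5184`, and a split `1 + 2` yields `1/18 * 5/288 = 5/5184`. -/
lemma le_distortion_withWalls_of_card (h : IsCantorDistribution P₁) (α : Finset ℝ) :
    ENNReal.ofReal (5 / 5184 * (4 - α.card)) ≤ distortion P₁ (withWalls α) := by
  rcases Nat.lt_or_ge 1 α.card with h1 | h1
  swap
  · refine (ENNReal.ofReal_le_ofReal ?_).trans (h.le_distortion_withWalls_of_card_le_one h1)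
    have : (0 : ℝ) ≤ α.card := by positivity
    linarith
  rcases Nat.lt_or_ge 3 α.card with h4 | h4
  · rw [ENNReal.ofReal_of_nonpos]
    · exact zero_le
    · have : (4 : ℝ) ≤ α.card := by exact_mod_cast h4
      linarith
  obtain ⟨β, γ, hcard, hle⟩ := h.le_distortion_withWalls α
  refine le_trans ?_ hle
  have empty : ∀ δ : Finset ℝ, δ.card = 0 →
      ENNReal.ofReal (5 / 144) ≤ distortion P₁ (withWalls δ) := fun δ hδ => by
    rw [Finset.card_eq_zero.1 hδ]
    exact h.le_distortion_withWalls_empty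
  have zero : ∀ δ : Finset ℝ, ENNReal.ofReal 0 ≤ distortion P₁ (withWalls δ) := by simp
  have combine : ∀ u v : ℝ, ENNReal.ofReal u ≤ distortion P₁ (withWalls β) →
      ENNReal.ofReal v ≤ distortion P₁ (withWalls γ) →
      5 / 5184 * (4 - (α.card : ℝ)) ≤ 1 / 18 * (u + v) →
      ENNReal.ofReal (5 / 5184 * (4 - α.card)) ≤
        ENNReal.ofReal (1 / 18) * (distortion P₁ (withWalls β) + distortion P₁ (withWalls γ)) :=
    fun u v hu hv huv => (ENNReal.ofReal_le_ofReal huv).trans (mul_add_ofReal_le hu hv)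
  have h2 : (2 : ℝ) ≤ α.card := by exact_mod_cast h1
  rcases Nat.lt_or_ge 1 β.card with hβ | hβ
  · rcases Nat.eq_zero_or_pos γ.card with hγ | hγ
    · exact combine 0 _ (zero β) (empty γ hγ) (by linarith)
    · have h3 : (3 : ℝ) ≤ α.card := by exact_mod_cast (by lia : 3 ≤ α.card)
      exact combine 0 _ (zero β) (h.le_distortion_withWalls_of_card_le_one (by lia))
        (by linarith)
  · rcases Nat.lt_or_ge 1 γ.card with hγ | hγ
    · rcases Nat.eq_zero_or_pos β.card with hβ0 | hβ0
      · exact combine _ 0 (empty β hβ0) (zero γ) (by linarith)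
      · have h3 : (3 : ℝ) ≤ α.card := by exact_mod_cast (by lia : 3 ≤ α.card)
        exact combine _ 0 (h.le_distortion_withWalls_of_card_le_one hβ) (zero γ)
          (by linarith)
    · exact combine _ _ (h.le_distortion_withWalls_of_card_le_one hβ)
        (h.le_distortion_withWalls_of_card_le_one hγ) (by linarith)

/-- An affine bound depends on the two parts only through the sum of their cardinalities, so how the
points split is irrelevant to the induction. -/
lemma le_distortion_withWalls_pow (h : IsCantorDistribution P₁) (k : ℕ) (α : Finset ℝ) :
    ENNReal.ofReal (5 / 5184 / 9 ^ k * (4 - α.card / 2 ^ k)) ≤ distortion P₁ (withWalls α) := by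
  induction k generalizing α with
  | zero => simpa using h.le_distortion_withWalls_of_card α
  | succ k ih =>
    obtain ⟨β, γ, hcard, hle⟩ := h.le_distortion_withWalls α
    refine le_trans (le_trans (ENNReal.ofReal_le_ofReal (le_of_eq ?_))
      (mul_add_ofReal_le (ih β) (ih γ))) hle
    rw [← hcard, pow_succ, pow_succ]
    push_cast
    field_simp
    ring

lemma le_quantizationError (h : IsCantorDistribution P₁) (k n : ℕ) :
    ENNReal.ofReal (5 / 5184 / 9 ^ k * (4 - n / 2 ^ k)) ≤ quantizationError P₁ n := by
  refine le_iInf₂ fun α hα => ?_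
  refine le_trans (ENNReal.ofReal_le_ofReal ?_) ((h.le_distortion_withWalls_pow k α).trans
    (distortion_anti fun a ha => mem_withWalls.2 (.inr (.inr ha))))
  gcongr

end IsCantorDistribution

/-! ### Scaled errors, quantization dimension and oscillation -/

/-- The Hausdorff dimension of the Cantor set. -/
noncomputable abbrev cantorDim : ℝ := Real.log 2 / Real.log 3

/-- The sequence `n ^ (2 / β) V_n(P)` whose limits are the quantization coefficients. -/
noncomputable def scaledError (P : Measure ℝ) (n : ℕ) : ℝ≥0∞ :=
  (n : ℝ≥0∞) ^ (2 / cantorDim) * quantizationError P n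

lemma cantorDim_pos : 0 < cantorDim :=
  div_pos (Real.log_pos (by norm_num)) (Real.log_pos (by norm_num))

lemma two_rpow_cantorDim : (2 : ℝ) ^ (2 / cantorDim) = 9 := by
  have h2 : Real.log 2 ≠ 0 := (Real.log_pos (by norm_num)).ne'
  rw [Real.rpow_def_of_pos (by norm_num), ← Real.exp_log (by norm_num : (0 : ℝ) < 9)]
  congr 1
  rw [show (9 : ℝ) = 3 ^ 2 by norm_num, Real.log_pow]
  unfold cantorDim
  field_simp
  norm_num

/-- The convergent `19/12` of `log 3 / log 2` is just good enough: `2^19 ≤ 3^12` gives the exponent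
bound `19/6`, and `(162/5)^6 < 3^19`. -/
lemma lt_three_rpow_cantorDim : 162 / 5 < (3 : ℝ) ^ (2 / cantorDim) := by
  have h2 : 0 < Real.log 2 := Real.log_pos (by norm_num)
  have h3 : 0 < Real.log 3 := Real.log_pos (by norm_num)
  have h : 19 * Real.log 2 ≤ 12 * Real.log 3 := by
    have := Real.log_le_log (by norm_num) (by norm_num : (2 : ℝ) ^ 19 ≤ 3 ^ 12)
    simpa [Real.log_pow] using this
  have hp : (19 / 6 : ℝ) ≤ 2 / cantorDim := by
    unfold cantorDim
    rw [div_div_eq_mul_div, div_le_div_iff₀ (by norm_num) h2]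
    linarith
  refine lt_of_lt_of_le ?_ (Real.rpow_le_rpow_of_exponent_le (by norm_num) hp)
  refine lt_of_pow_lt_pow_left₀ 6 (by positivity) ?_
  rw [← Real.rpow_natCast (3 ^ (19 / 6 : ℝ)), ← Real.rpow_mul (by norm_num)]
  norm_num

lemma two_pow_rpow_cantorDim (k : ℕ) : ((2 : ℝ) ^ k) ^ (2 / cantorDim) = 9 ^ k := by
  rw [← Real.rpow_natCast, ← Real.rpow_mul (by norm_num), mul_comm, Real.rpow_mul (by norm_num),
    two_rpow_cantorDim, Real.rpow_natCast]

lemma natCast_rpow (n : ℕ) :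
    (n : ℝ≥0∞) ^ (2 / cantorDim) = ENNReal.ofReal ((n : ℝ) ^ (2 / cantorDim)) := by
  rw [← ENNReal.ofReal_rpow_of_nonneg (by positivity) (div_pos two_pos cantorDim_pos).le,
    ENNReal.ofReal_natCast]

/-- Two-sided bounds on `n ^ (2 / β) V_n(P)` determine the quantization dimension. -/
lemma hasQuantizationDimension_of_bounds {P : Measure ℝ} {c C : ℝ} (hc : 0 < c)
    (hlow : ∀ᶠ n in atTop, ENNReal.ofReal c ≤ scaledError P n)
    (hup : ∀ᶠ n in atTop, scaledError P n ≤ ENNReal.ofReal C) :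
    HasQuantizationDimension P (cantorDim : EReal) := by
  have hlogn : Tendsto (fun n : ℕ => Real.log n) atTop atTop :=
    Real.tendsto_log_atTop.comp tendsto_natCast_atTop_atTop
  set p : ℝ := 2 / cantorDim with hp
  have hp0 : 0 < p := div_pos two_pos cantorDim_pos
  have hbound : ∀ᶠ n : ℕ in atTop,
      Real.log c ≤ p * Real.log n + Real.log (quantizationError P n).toReal ∧
      p * Real.log n + Real.log (quantizationError P n).toReal ≤ Real.log C := by
    filter_upwards [hlow, hup, eventually_ge_atTop 1] with n h1 h2 hn
    have hn' : (0 : ℝ) < n := by exact_mod_cast hn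
    have hne : scaledError P n ≠ ∞ := ne_top_of_le_ne_top ENNReal.ofReal_ne_top h2
    have heq : (scaledError P n).toReal = (n : ℝ) ^ p * (quantizationError P n).toReal := by
      rw [scaledError, natCast_rpow, ENNReal.toReal_mul, ENNReal.toReal_ofReal (by positivity)]
    have h1' : c ≤ (scaledError P n).toReal := (ENNReal.ofReal_le_iff_le_toReal hne).1 h1
    have hpos : 0 < (scaledError P n).toReal := hc.trans_le h1'
    have h2' : (scaledError P n).toReal ≤ C := by
      have hC : 0 < C := by
        by_contra! hC
        rw [ENNReal.ofReal_of_nonpos hC, nonpos_iff_eq_zero] at h2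
        simp [h2] at hpos
      exact ENNReal.toReal_le_of_le_ofReal hC.le h2
    -- The lower bound excludes a vanishing error, for which the logarithm would take its default
    -- value.
    have hV : (quantizationError P n).toReal ≠ 0 := by
      intro h0
      rw [heq, h0, mul_zero] at hpos
      exact hpos.false
    have hlog : Real.log (scaledError P n).toReal
        = p * Real.log n + Real.log (quantizationError P n).toReal := by
      rw [heq, Real.log_mul (Real.rpow_pos_of_pos hn' p).ne' hV, Real.log_rpow hn']
    rw [← hlog]
    exact ⟨Real.log_le_log hc h1', Real.log_le_log hpos h2'⟩
  have hquot : Tendsto (fun n : ℕ => -Real.log (quantizationError P n).toReal / Real.log n) atTop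
      (𝓝 p) := by
    have hl : Tendsto (fun n : ℕ => p - Real.log C / Real.log n) atTop (𝓝 p) := by
      simpa using tendsto_const_nhds.sub (hlogn.const_div_atTop (Real.log C))
    have hu : Tendsto (fun n : ℕ => p - Real.log c / Real.log n) atTop (𝓝 p) := by
      simpa using tendsto_const_nhds.sub (hlogn.const_div_atTop (Real.log c))
    refine tendsto_of_tendsto_of_tendsto_of_le_of_le' hl hu ?_ ?_
    · filter_upwards [hbound, hlogn.eventually_gt_atTop 0] with n hn h0
      rw [le_div_iff₀ h0, sub_mul, div_mul_cancel₀ _ h0.ne']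
      linarith [hn.2]
    · filter_upwards [hbound, hlogn.eventually_gt_atTop 0] with n hn h0
      rw [div_le_iff₀ h0, sub_mul, div_mul_cancel₀ _ h0.ne']
      linarith [hn.1]
  have hratio : Tendsto (dimensionRatio P) atTop (𝓝 cantorDim) := by
    have h := (hquot.inv₀ hp0.ne').const_mul 2
    have h2 : 2 * p⁻¹ = cantorDim := by
      rw [hp, inv_div]
      ring
    rw [h2] at h
    refine h.congr fun n => ?_
    rw [dimensionRatio, inv_div]
    ring
  have hE : Tendsto (fun n : ℕ => (dimensionRatio P n : EReal)) atTop (𝓝 (cantorDim : EReal)) :=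
    (continuous_coe_real_ereal.tendsto _).comp hratio
  exact ⟨hE.liminf_eq, hE.limsup_eq⟩

namespace IsCantorDistribution

variable {P₁ : Measure ℝ}

lemma scaledError_two_pow_le (h : IsCantorDistribution P₁) (k : ℕ) :
    scaledError P₁ (2 ^ k) ≤ ENNReal.ofReal (1 / 32) := by
  rw [scaledError, natCast_rpow]
  push_cast
  rw [two_pow_rpow_cantorDim]
  refine (mul_le_mul_right (h.quantizationError_two_pow_le k) _).trans ?_
  rw [← ENNReal.ofReal_mul (by positivity)]
  refine ENNReal.ofReal_le_ofReal (le_of_eq ?_)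
  field_simp

lemma le_scaledError_three_mul_two_pow (h : IsCantorDistribution P₁) (k : ℕ) :
    ENNReal.ofReal ((3 : ℝ) ^ (2 / cantorDim) * (5 / 5184)) ≤ scaledError P₁ (3 * 2 ^ k) := by
  rw [scaledError, natCast_rpow]
  push_cast
  rw [Real.mul_rpow (by norm_num) (by positivity), two_pow_rpow_cantorDim]
  refine le_trans ?_ (mul_le_mul_right (h.le_quantizationError k _) _)
  rw [← ENNReal.ofReal_mul (by positivity)]
  refine ENNReal.ofReal_le_ofReal (le_of_eq ?_)
  push_cast
  field_simp
  norm_num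

lemma scaledError_le (h : IsCantorDistribution P₁) {n : ℕ} (hn : n ≠ 0) :
    scaledError P₁ n ≤ ENNReal.ofReal (9 / 32) := by
  set k := Nat.log 2 n
  have h1 : 2 ^ k ≤ n := Nat.pow_log_le_self 2 hn
  have h2 : n < 2 ^ (k + 1) := Nat.lt_pow_succ_log_self one_lt_two n
  have hpow : (n : ℝ) ^ (2 / cantorDim) ≤ 9 ^ (k + 1) := by
    rw [← two_pow_rpow_cantorDim]
    exact Real.rpow_le_rpow (by positivity) (by exact_mod_cast h2.le)
      (div_pos two_pos cantorDim_pos).le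
  rw [scaledError, natCast_rpow]
  calc _ ≤ ENNReal.ofReal (9 ^ (k + 1)) * ENNReal.ofReal (1 / 32 / 9 ^ k) :=
        mul_le_mul' (ENNReal.ofReal_le_ofReal hpow)
          ((quantizationError_anti h1).trans (h.quantizationError_two_pow_le k))
    _ = ENNReal.ofReal (9 / 32) := by
        rw [← ENNReal.ofReal_mul (by positivity), pow_succ]
        congr 1
        field_simp

lemma le_scaledError (h : IsCantorDistribution P₁) {n : ℕ} (hn : n ≠ 0) :
    ENNReal.ofReal (5 / 15552) ≤ scaledError P₁ n := by
  set k := Nat.log 2 n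
  have h1 : 2 ^ k ≤ n := Nat.pow_log_le_self 2 hn
  have h2 : n < 2 ^ (k + 1) := Nat.lt_pow_succ_log_self one_lt_two n
  have hpow : 9 ^ k ≤ (n : ℝ) ^ (2 / cantorDim) := by
    rw [← two_pow_rpow_cantorDim]
    exact Real.rpow_le_rpow (by positivity) (by exact_mod_cast h1)
      (div_pos two_pos cantorDim_pos).le
  rw [scaledError, natCast_rpow]
  calc ENNReal.ofReal (5 / 15552)
      = ENNReal.ofReal (9 ^ k) * ENNReal.ofReal (5 / 5184 / 9 ^ (k + 1) * 3) := by
        rw [← ENNReal.ofReal_mul (by positivity), pow_succ]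
        congr 1
        field_simp
        norm_num
    _ ≤ _ := by
        refine mul_le_mul' (ENNReal.ofReal_le_ofReal hpow)
          (le_trans (ENNReal.ofReal_le_ofReal ?_) (h.le_quantizationError (k + 1) n))
        -- Using level `k + 1` rather than `k` keeps the factor `4 - n / 2^(k+1)` at least `3`.
        have h3 : (n : ℝ) / 2 ^ (k + 1) ≤ 1 := (div_le_one (by positivity)).2
          (by exact_mod_cast h2.le)
        gcongr
        linarith

lemma not_tendsto_scaledError (h : IsCantorDistribution P₁) (c : ℝ≥0∞) :
    ¬ Tendsto (scaledError P₁) atTop (𝓝 c) := by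
  intro hc
  have t2 : Tendsto (fun k : ℕ => 2 ^ k) atTop atTop :=
    tendsto_pow_atTop_atTop_of_one_lt one_lt_two
  have t3 : Tendsto (fun k : ℕ => 3 * 2 ^ k) atTop atTop :=
    t2.const_mul_atTop' (by norm_num)
  have hle : c ≤ ENNReal.ofReal (1 / 32) :=
    le_of_tendsto' (hc.comp t2) h.scaledError_two_pow_le
  have hge : ENNReal.ofReal ((3 : ℝ) ^ (2 / cantorDim) * (5 / 5184)) ≤ c :=
    ge_of_tendsto' (hc.comp t3) h.le_scaledError_three_mul_two_pow
  have := (ENNReal.ofReal_le_ofReal_iff (by norm_num)).1 (hge.trans hle)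
  linarith [lt_three_rpow_cantorDim]

end IsCantorDistribution

/-! ### The mixed distribution -/

lemma distortion_mixedDistribution (P₁ : Measure ℝ) (α : Finset ℝ) :
    distortion (mixedDistribution P₁) α
      = 2⁻¹ * distortion P₁ α + 2⁻¹ * distortion discreteD α := by
  unfold distortion mixedDistribution
  rw [lintegral_add_measure, lintegral_smul_measure, lintegral_smul_measure, smul_eq_mul,
    smul_eq_mul]

lemma distortion_discreteD_eq_zero {α : Finset ℝ} (h1 : 2 / 3 ∈ α) (h2 : 5 / 6 ∈ α)
    (h3 : 1 ∈ α) : distortion discreteD α = 0 := by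
  have key : ∀ a ∈ α, ⨅ b ∈ α, ‖a - b‖ₑ ^ 2 = 0 := fun a ha =>
    le_antisymm ((iInf₂_le a ha).trans (by simp)) zero_le
  unfold distortion discreteD
  rw [lintegral_smul_measure, lintegral_add_measure, lintegral_add_measure, lintegral_dirac,
    lintegral_dirac, lintegral_dirac, key _ h1, key _ h2, key _ h3]
  simp

/-- The discrete half contributes nonnegatively and can be dropped. -/
lemma half_quantizationError_le (P₁ : Measure ℝ) (n : ℕ) :
    2⁻¹ * quantizationError P₁ n ≤ quantizationError (mixedDistribution P₁) n := by
  refine le_iInf₂ fun α hα => ?_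
  rw [distortion_mixedDistribution]
  exact (mul_le_mul_right (quantizationError_le α hα) _).trans le_self_add

/-- Adding the three atoms to a competitor for `P₁` makes the discrete half vanish. -/
lemma quantizationError_mixedDistribution_le (P₁ : Measure ℝ) (n : ℕ) :
    quantizationError (mixedDistribution P₁) (n + 3) ≤ 2⁻¹ * quantizationError P₁ n := by
  have h0 : (2⁻¹ : ℝ≥0∞) ≠ 0 := by norm_num
  have ht : (2⁻¹ : ℝ≥0∞) ≠ ∞ := by norm_num
  conv_rhs => unfold quantizationError
  rw [ENNReal.mul_iInf_of_ne h0 ht]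
  refine le_iInf fun β => ?_
  rw [ENNReal.mul_iInf_of_ne h0 ht]
  refine le_iInf fun hβ => ?_
  set α : Finset ℝ := insert (2 / 3) (insert (5 / 6) (insert 1 β))
  have hcard : α.card ≤ n + 3 := by
    have h1 := Finset.card_insert_le (2 / 3 : ℝ) (insert (5 / 6) (insert 1 β))
    have h2 := Finset.card_insert_le (5 / 6 : ℝ) (insert 1 β)
    have h3 := Finset.card_insert_le (1 : ℝ) β
    lia
  refine (quantizationError_le α hcard).trans ?_
  rw [distortion_mixedDistribution, distortion_discreteD_eq_zero (by simp [α]) (by simp [α])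
    (by simp [α]), mul_zero, add_zero]
  refine mul_le_mul_right (distortion_anti fun b hb => ?_) _
  simp [α, hb]

lemma half_scaledError_le (P₁ : Measure ℝ) (n : ℕ) :
    2⁻¹ * scaledError P₁ n ≤ scaledError (mixedDistribution P₁) n := by
  unfold scaledError
  rw [mul_left_comm]
  exact mul_le_mul_right (half_quantizationError_le P₁ n) _

/-- The factor by which `n ^ (2 / β)` changes under a shift by `3`. -/
noncomputable def shiftFactor (n : ℕ) : ℝ≥0∞ :=
  ENNReal.ofReal ((((n + 3 : ℕ) : ℝ) / n) ^ (2 / cantorDim))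

lemma tendsto_shiftFactor : Tendsto shiftFactor atTop (𝓝 1) := by
  have h1 : Tendsto (fun n : ℕ => ((n + 3 : ℕ) : ℝ) / n) atTop (𝓝 1) := by
    have : Tendsto (fun n : ℕ => 1 + 3 / (n : ℝ)) atTop (𝓝 1) := by
      simpa using tendsto_const_nhds.add (tendsto_const_div_atTop_nhds_zero_nat (3 : ℝ))
    refine this.congr' ?_
    filter_upwards [eventually_ne_atTop 0] with n hn
    push_cast
    field_simp
  have h2 := h1.rpow_const (p := 2 / cantorDim) (.inl one_ne_zero)
  rw [Real.one_rpow] at h2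
  have h3 := ENNReal.tendsto_ofReal h2
  rwa [ENNReal.ofReal_one] at h3

lemma scaledError_mixedDistribution_le (P₁ : Measure ℝ) {n : ℕ} (hn : n ≠ 0) :
    scaledError (mixedDistribution P₁) (n + 3) ≤ shiftFactor n * (2⁻¹ * scaledError P₁ n) := by
  have hn' : (0 : ℝ) < n := by positivity
  have e : ENNReal.ofReal (((n + 3 : ℕ) : ℝ) ^ (2 / cantorDim))
      = shiftFactor n * ENNReal.ofReal ((n : ℝ) ^ (2 / cantorDim)) := by
    rw [shiftFactor, ← ENNReal.ofReal_mul (by positivity), ← Real.mul_rpow (by positivity)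
      (by positivity), div_mul_cancel₀ _ hn'.ne']
  unfold scaledError
  rw [natCast_rpow, natCast_rpow, e, mul_left_comm 2⁻¹, mul_assoc]
  gcongr
  exact quantizationError_mixedDistribution_le P₁ n

lemma liminf_scaledError_mixedDistribution (P₁ : Measure ℝ) :
    liminf (scaledError (mixedDistribution P₁)) atTop = 2⁻¹ * liminf (scaledError P₁) atTop := by
  have hhalf : liminf (fun n => 2⁻¹ * scaledError P₁ n) atTop
      = 2⁻¹ * liminf (scaledError P₁) atTop :=
    ENNReal.liminf_const_mul_of_ne_top (by norm_num)
  rw [← hhalf]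
  refine le_antisymm ?_ (liminf_le_liminf (.of_forall (half_scaledError_le P₁)))
  rw [← liminf_nat_add _ 3]
  have hs := tendsto_shiftFactor.limsup_eq
  calc _ ≤ liminf (shiftFactor * fun n => 2⁻¹ * scaledError P₁ n) atTop :=
        liminf_le_liminf ((eventually_ne_atTop 0).mono fun n hn =>
          scaledError_mixedDistribution_le P₁ hn)
    _ ≤ limsup shiftFactor atTop * liminf (fun n => 2⁻¹ * scaledError P₁ n) atTop :=
        ENNReal.liminf_mul_le (.inl (by simp [hs])) (.inl (by simp [hs]))
    _ = _ := by rw [hs, one_mul]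

lemma limsup_scaledError_mixedDistribution (P₁ : Measure ℝ) :
    limsup (scaledError (mixedDistribution P₁)) atTop = 2⁻¹ * limsup (scaledError P₁) atTop := by
  have hhalf : limsup (fun n => 2⁻¹ * scaledError P₁ n) atTop
      = 2⁻¹ * limsup (scaledError P₁) atTop :=
    ENNReal.limsup_const_mul_of_ne_top (by norm_num)
  rw [← hhalf]
  refine le_antisymm ?_ (limsup_le_limsup (.of_forall (half_scaledError_le P₁)))
  rw [← limsup_nat_add _ 3]
  have hs := tendsto_shiftFactor.limsup_eq
  calc _ ≤ limsup (shiftFactor * fun n => 2⁻¹ * scaledError P₁ n) atTop :=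
        limsup_le_limsup ((eventually_ne_atTop 0).mono fun n hn =>
          scaledError_mixedDistribution_le P₁ hn)
    _ ≤ limsup shiftFactor atTop * limsup (fun n => 2⁻¹ * scaledError P₁ n) atTop :=
        ENNReal.limsup_mul_le' (.inl (by simp [hs])) (.inl (by simp [hs]))
    _ = _ := by rw [hs, one_mul]

namespace IsCantorDistribution

variable {P₁ : Measure ℝ}

lemma hasQuantizationDimension (h : IsCantorDistribution P₁) :
    HasQuantizationDimension P₁ (cantorDim : EReal) :=
  hasQuantizationDimension_of_bounds (by norm_num)
    ((eventually_ne_atTop 0).mono fun _ => h.le_scaledError)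
    ((eventually_ne_atTop 0).mono fun _ => h.scaledError_le)

lemma hasQuantizationDimension_mixedDistribution (h : IsCantorDistribution P₁) :
    HasQuantizationDimension (mixedDistribution P₁) (cantorDim : EReal) := by
  -- The limsup is at most `9/64`; the strict gap to `9/32` turns it into an eventual bound.
  have hlow : limsup (scaledError (mixedDistribution P₁)) atTop < ENNReal.ofReal (9 / 32) := by
    rw [limsup_scaledError_mixedDistribution]
    have h1 : limsup (scaledError P₁) atTop ≤ ENNReal.ofReal (9 / 32) :=
      limsup_le_of_le (h := (eventually_ne_atTop 0).mono fun _ => h.scaledError_le)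
    calc _ ≤ ENNReal.ofReal (1 / 2) * ENNReal.ofReal (9 / 32) := by
          gcongr
          rw [one_div, ENNReal.ofReal_inv_of_pos (by norm_num), ENNReal.ofReal_ofNat]
      _ < _ := by
          rw [← ENNReal.ofReal_mul (by norm_num)]
          exact (ENNReal.ofReal_lt_ofReal_iff (by norm_num)).2 (by norm_num)
  refine hasQuantizationDimension_of_bounds (c := 1 / 2 * (5 / 15552)) (by norm_num) ?_
    ((eventually_lt_of_limsup_lt hlow).mono fun _ => le_of_lt)
  filter_upwards [eventually_ne_atTop 0] with n hn
  refine le_trans ?_ (half_scaledError_le P₁ n)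
  rw [ENNReal.ofReal_mul (by norm_num), one_div, ENNReal.ofReal_inv_of_pos (by norm_num),
    ENNReal.ofReal_ofNat]
  exact mul_le_mul_right (h.le_scaledError hn) _

lemma not_tendsto_scaledError_mixedDistribution (h : IsCantorDistribution P₁) (c : ℝ≥0∞) :
    ¬ Tendsto (scaledError (mixedDistribution P₁)) atTop (𝓝 c) := by
  intro hc
  -- A limit for the mixture would equate its lower and upper coefficients, hence also those of `P₁`
  -- after cancelling `1/2`.
  have e : liminf (scaledError P₁) atTop = limsup (scaledError P₁) atTop := by
    have e2 := hc.liminf_eq.trans hc.limsup_eq.symm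
    rw [liminf_scaledError_mixedDistribution, limsup_scaledError_mixedDistribution] at e2
    exact (ENNReal.mul_right_inj (by norm_num) (by norm_num)).1 e2
  exact h.not_tendsto_scaledError _ (tendsto_of_liminf_eq_limsup e rfl)

end IsCantorDistribution

/-! ### The Hausdorff dimension of the Cantor set -/

lemma edist_S (i : Fin 2) (x y : ℝ) : edist x y = ENNReal.ofReal 3 * edist (S i x) (S i y) := by
  rw [edist_dist, edist_dist, ← ENNReal.ofReal_mul (by norm_num), Real.dist_eq, Real.dist_eq]
  congr 1
  have : S i x - S i y = (x - y) / 3 := by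
    unfold S
    split_ifs <;> ring
  rw [this, abs_div, abs_of_pos (by norm_num : (0 : ℝ) < 3)]
  ring

lemma edist_wordMap (σ : List (Fin 2)) (x y : ℝ) :
    edist (wordMap σ x) (wordMap σ y) = ENNReal.ofReal (1 / 3 ^ σ.length) * edist x y := by
  induction σ with
  | nil => simp [wordMap]
  | cons i σ ih =>
    have h : ENNReal.ofReal (1 / 3) * ENNReal.ofReal 3 = 1 := by
      rw [← ENNReal.ofReal_mul (by norm_num)]
      norm_num
    have e := edist_S i (wordMap σ x) (wordMap σ y)
    rw [ih] at e
    change edist (S i (wordMap σ x)) (S i (wordMap σ y)) = _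
    rw [← one_mul (edist (S i _) _), ← h, mul_assoc, ← e, ← mul_assoc,
      ← ENNReal.ofReal_mul (by norm_num), List.length_cons, pow_succ]
    congr 2
    field_simp

lemma continuous_wordMap (σ : List (Fin 2)) : Continuous (wordMap σ) := by
  induction σ with
  | nil => exact continuous_id
  | cons i σ ih =>
    have : Continuous (S i) := by
      unfold S
      split_ifs <;> fun_prop
    exact this.comp ih

/-- The union of the `2 ^ k` basic intervals of level `k`. -/
def cantorLevel (k : ℕ) : Set ℝ :=
  ⋃ (σ : List (Fin 2)) (_ : σ.length = k), wordMap σ '' Set.Icc 0 (1 / 2)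

lemma measurableSet_cantorLevel (k : ℕ) : MeasurableSet (cantorLevel k) :=
  .iUnion fun σ => .iUnion fun _ =>
    (isCompact_Icc.image (continuous_wordMap σ)).isClosed.measurableSet

lemma cantorLevel_subset_preimage (k : ℕ) (i : Fin 2) :
    cantorLevel k ⊆ S i ⁻¹' cantorLevel (k + 1) := by
  intro x hx
  simp only [cantorLevel, Set.mem_iUnion] at hx
  obtain ⟨σ, hσ, y, hy, rfl⟩ := hx
  exact Set.mem_iUnion₂.2 ⟨i :: σ, by simp [hσ], y, hy, rfl⟩

lemma cantorDim_le_one : cantorDim ≤ 1 :=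
  (div_le_one (Real.log_pos (by norm_num))).2 (Real.log_le_log (by norm_num) (by norm_num))

lemma three_rpow : (3 : ℝ) ^ cantorDim = 2 := by
  have h3 : Real.log 3 ≠ 0 := (Real.log_pos (by norm_num)).ne'
  rw [Real.rpow_def_of_pos (by norm_num), mul_div_cancel₀ _ h3, Real.exp_log (by norm_num)]

lemma rpow_length (k : ℕ) :
    (1 / 2 / 3 ^ k : ℝ) ^ cantorDim = (1 / 2) ^ cantorDim / 2 ^ k := by
  rw [Real.div_rpow (by norm_num) (by positivity), ← Real.rpow_natCast, ← Real.rpow_mul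
    (by norm_num), mul_comm, Real.rpow_mul (by norm_num), three_rpow, Real.rpow_natCast]

open Measure in
-- Since `3^β = 2`, the `β`-th powers of the lengths of the `2^k` basic intervals sum to `(1/2)^β`
-- at every level.
lemma hausdorffMeasure_cantorC_ne_top : μH[cantorDim] cantorC ≠ ∞ := by
  have hlen : Tendsto (fun k : ℕ => ENNReal.ofReal (1 / 2 / 3 ^ k)) atTop (𝓝 0) := by
    have h : Tendsto (fun k : ℕ => (1 / 2 / 3 ^ k : ℝ)) atTop (𝓝 0) :=
      (tendsto_pow_atTop_atTop_of_one_lt (by norm_num)).const_div_atTop _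
    simpa using ENNReal.tendsto_ofReal h
  have hdiam : ∀ (k : ℕ) (σ : List.Vector (Fin 2) k),
      Metric.ediam (wordMap σ.1 '' Set.Icc 0 (1 / 2)) ≤ ENNReal.ofReal (1 / 2 / 3 ^ k) := by
    intro k σ
    refine Metric.ediam_le ?_
    rintro _ ⟨x, hx, rfl⟩ _ ⟨y, hy, rfl⟩
    rw [edist_wordMap, σ.2, edist_dist, ← ENNReal.ofReal_mul (by positivity)]
    refine ENNReal.ofReal_le_ofReal ?_
    have := Real.dist_le_of_mem_Icc hx hy
    calc 1 / 3 ^ k * dist x y ≤ 1 / 3 ^ k * (1 / 2 - 0) := by gcongr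
      _ = _ := by ring
  have hle := hausdorffMeasure_le_liminf_sum cantorDim cantorC _ hlen
    (fun k (σ : List.Vector (Fin 2) k) => wordMap σ.1 '' Set.Icc 0 (1 / 2))
    (.of_forall hdiam) (.of_forall fun k x hx => by
      obtain ⟨σ, hσ, hx⟩ := Set.mem_iUnion₂.1 (Set.mem_iInter.1 hx k)
      exact Set.mem_iUnion.2 ⟨⟨σ, hσ⟩, hx⟩)
  refine ne_top_of_le_ne_top (ENNReal.ofReal_ne_top (r := (1 / 2) ^ cantorDim)) (hle.trans ?_)
  refine (liminf_le_liminf (.of_forall fun k => ?_)).trans (liminf_const _).le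
  calc ∑ σ : List.Vector (Fin 2) k, Metric.ediam (wordMap σ.1 '' Set.Icc 0 (1 / 2)) ^ cantorDim
      ≤ ∑ _σ : List.Vector (Fin 2) k, ENNReal.ofReal ((1 / 2) ^ cantorDim / 2 ^ k) := by
        refine Finset.sum_le_sum fun σ _ => ?_
        rw [← rpow_length, ← ENNReal.ofReal_rpow_of_nonneg (by positivity) cantorDim_pos.le]
        exact ENNReal.rpow_le_rpow (hdiam k σ) cantorDim_pos.le
    _ = ENNReal.ofReal ((1 / 2) ^ cantorDim) := by
        rw [Finset.sum_const, Finset.card_univ, card_vector, Fintype.card_fin, nsmul_eq_mul,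
          ← ENNReal.ofReal_natCast, ← ENNReal.ofReal_mul (by positivity)]
        congr 1
        push_cast
        field_simp

namespace IsCantorDistribution

variable {P₁ : Measure ℝ}

lemma measure_cantorLevel (h : IsCantorDistribution P₁) (k : ℕ) : P₁ (cantorLevel k) = 1 := by
  have := h.isProbabilityMeasure
  refine le_antisymm prob_le_one ?_
  induction k with
  | zero =>
    rw [← (prob_compl_eq_zero_iff measurableSet_Icc).1 h.ae_mem_Icc]
    exact measure_mono fun x hx => Set.mem_iUnion₂.2 ⟨[], rfl, x, hx, rfl⟩
  | succ k ih =>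
    exact ih.trans (h.measure_of_subset_preimage (measurableSet_cantorLevel _)
      (cantorLevel_subset_preimage k))

lemma measure_cantorC (h : IsCantorDistribution P₁) : P₁ cantorC = 1 := by
  have := h.isProbabilityMeasure
  refine (prob_compl_eq_zero_iff (.iInter measurableSet_cantorLevel)).1 ?_
  rw [Set.compl_iInter, measure_iUnion_null_iff]
  exact fun k => (prob_compl_eq_zero_iff (measurableSet_cantorLevel k)).2 (h.measure_cantorLevel k)

lemma measure_eq_zero_of_disjoint (h : IsCantorDistribution P₁) {s : Set ℝ}
    (hs : ∀ x ∈ Set.Icc (0 : ℝ) (1 / 2), x ∉ s) : P₁ s = 0 :=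
  measure_mono_null (fun x hx hI => hs x hI hx) h.ae_mem_Icc

/-- A set this small meets at most one of the two halves of the support, so passing to its preimages
halves the mass bound while tripling the diameter. -/
lemma measure_le_of_ediam_lt (h : IsCantorDistribution P₁) (k : ℕ) {s : Set ℝ}
    (hs : MeasurableSet s) (hd : Metric.ediam s < ENNReal.ofReal (1 / 2 / 3 ^ k)) :
    P₁ s ≤ ENNReal.ofReal (1 / 2 ^ k) := by
  have := h.isProbabilityMeasure
  induction k generalizing s with
  | zero => simpa using prob_le_one
  | succ k ih =>
    have half : ∀ i, P₁ (S i ⁻¹' s) ≤ ENNReal.ofReal (1 / 2 ^ k) := by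
      intro i
      refine ih (measurable_S i hs) ?_
      have h3 : ENNReal.ofReal (1 / 2 / 3 ^ k)
          = ENNReal.ofReal 3 * ENNReal.ofReal (1 / 2 / 3 ^ (k + 1)) := by
        rw [← ENNReal.ofReal_mul (by norm_num), pow_succ]
        congr 1
        field_simp
      have hle : Metric.ediam (S i ⁻¹' s) ≤ ENNReal.ofReal 3 * Metric.ediam s := by
        refine Metric.ediam_le fun x hx y hy => ?_
        rw [edist_S i x y]
        gcongr
        exact Metric.edist_le_ediam_of_mem hx hy
      rw [h3]
      exact hle.trans_lt (ENNReal.mul_lt_mul_right (by norm_num) ENNReal.ofReal_ne_top hd)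
    have key : P₁ (S 0 ⁻¹' s) = 0 ∨ P₁ (S 1 ⁻¹' s) = 0 := by
      by_contra! hne
      obtain ⟨x, hxI, hx⟩ : ∃ x ∈ Set.Icc (0 : ℝ) (1 / 2), S 0 x ∈ s := by
        by_contra! hno
        exact hne.1 (h.measure_eq_zero_of_disjoint hno)
      obtain ⟨y, hyI, hy⟩ : ∃ y ∈ Set.Icc (0 : ℝ) (1 / 2), S 1 y ∈ s := by
        by_contra! hno
        exact hne.2 (h.measure_eq_zero_of_disjoint hno)
      have hxy := (Metric.edist_le_ediam_of_mem hy hx).trans_lt hd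
      rw [edist_dist, ENNReal.ofReal_lt_ofReal_iff (by positivity), Real.dist_eq, S_apply_zero,
        S_apply_one, abs_lt] at hxy
      -- The halves lie in `[0, 1/6]` and `[1/3, 1/2]`, separated by a gap of `1/6`.
      have h6 : (1 / 2 / 3 ^ (k + 1) : ℝ) ≤ 1 / 6 := by
        rw [div_div]
        refine one_div_le_one_div_of_le (by norm_num) ?_
        have : (1 : ℝ) ≤ 3 ^ k := one_le_pow₀ (by norm_num)
        rw [pow_succ]
        linarith
      linarith [hxy.2, hxI.2, hyI.1]
    have e : ENNReal.ofReal (1 / 2 ^ (k + 1)) = 2⁻¹ * ENNReal.ofReal (1 / 2 ^ k) := by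
      rw [← ENNReal.ofReal_ofNat 2, ← ENNReal.ofReal_inv_of_pos (by norm_num),
        ← ENNReal.ofReal_mul (by norm_num), pow_succ]
      congr 1
      field_simp
    rw [h.measure_eq hs, e]
    rcases key with h0 | h0
    · rw [h0, mul_zero, zero_add]
      exact mul_le_mul_right (half 1) _
    · rw [h0, mul_zero, add_zero]
      exact mul_le_mul_right (half 0) _

/-- The Cantor distribution of a small set is bounded by a power of its diameter. -/
lemma measure_le_ediam_rpow (h : IsCantorDistribution P₁) {s : Set ℝ}
    (hs : MeasurableSet s) (hd : Metric.ediam s ≤ ENNReal.ofReal (1 / 6)) :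
    ENNReal.ofReal (1 / 4) * P₁ s ≤ Metric.ediam s ^ cantorDim := by
  by_cases hex : ∃ k : ℕ, ENNReal.ofReal (1 / 2 / 3 ^ k) ≤ Metric.ediam s
  · classical
    -- The first scale not exceeding the diameter is taken; it is not level `0`, because the
    -- diameter is at most `1/6 < 1/2`.
    obtain ⟨hk, hmin⟩ := Nat.find_spec hex, fun m => Nat.find_min (m := m) hex
    generalize Nat.find hex = k at hk hmin
    rcases k with _ | k
    · have := (ENNReal.ofReal_le_ofReal_iff (by norm_num)).1 (hk.trans hd)
      norm_num at this
    · have hP := h.measure_le_of_ediam_lt k hs (not_le.1 (hmin k (Nat.lt_succ_self k)))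
      refine le_trans ?_ (ENNReal.rpow_le_rpow hk cantorDim_pos.le)
      refine (mul_le_mul_right hP _).trans ?_
      rw [ENNReal.ofReal_rpow_of_nonneg (by positivity) cantorDim_pos.le, rpow_length,
        ← ENNReal.ofReal_mul (by norm_num)]
      refine ENNReal.ofReal_le_ofReal ?_
      have h2 : (1 / 2 : ℝ) ≤ (1 / 2) ^ cantorDim := by
        simpa using Real.rpow_le_rpow_of_exponent_ge (x := 1 / 2) (by norm_num) (by norm_num)
          cantorDim_le_one
      calc (1 / 4 * (1 / 2 ^ k) : ℝ) = 1 / 2 / 2 ^ (k + 1) := by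
            rw [pow_succ]
            field_simp
            norm_num
        _ ≤ _ := by gcongr
  · push Not at hex
    have hlim : Tendsto (fun k : ℕ => ENNReal.ofReal (1 / 2 ^ k)) atTop (𝓝 0) := by
      have h : Tendsto (fun k : ℕ => (1 / 2 ^ k : ℝ)) atTop (𝓝 0) :=
        (tendsto_pow_atTop_atTop_of_one_lt (by norm_num)).const_div_atTop _
      simpa using ENNReal.tendsto_ofReal h
    have h0 : P₁ s = 0 := le_antisymm
      (ge_of_tendsto' hlim fun k => h.measure_le_of_ediam_lt k hs (hex k)) zero_le
    simp [h0]

open Measure in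
-- Mass distribution principle: `P₁ / 4` is dominated by the Hausdorff measure, and `P₁` gives the
-- Cantor set full mass.
lemma hausdorffMeasure_cantorC_ne_zero (h : IsCantorDistribution P₁) :
    μH[cantorDim] cantorC ≠ 0 := by
  have hle : ENNReal.ofReal (1 / 4) • P₁ ≤ μH[cantorDim] := by
    refine le_hausdorffMeasure _ _ (ENNReal.ofReal (1 / 6)) (by norm_num) fun s hs => ?_
    -- The test set need not be measurable; its closure is, and has the same diameter.
    rw [← Metric.ediam_closure] at hs ⊢
    exact (measure_mono subset_closure).trans
      (h.measure_le_ediam_rpow isClosed_closure.measurableSet hs)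
  have := hle cantorC
  rw [Measure.smul_apply, h.measure_cantorC] at this
  intro h0
  rw [h0] at this
  norm_num at this

end IsCantorDistribution

lemma dimH_cantorC {P₁ : Measure ℝ} (h : IsCantorDistribution P₁) :
    dimH cantorC = ENNReal.ofReal cantorDim := by
  refine dimH_of_hausdorffMeasure_ne_zero_ne_top (d := cantorDim.toNNReal) ?_ ?_ <;>
    rw [Real.coe_toNNReal _ cantorDim_pos.le]
  · exact h.hausdorffMeasure_cantorC_ne_zero
  · exact hausdorffMeasure_cantorC_ne_top

end Quantization

theorem mainTheorem10 (P₁ : Measure ℝ) (hP₁ : Quantization.IsCantorDistribution P₁) :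
    -- the Hausdorff dimension of the Cantor set
    dimH Quantization.cantorC = ENNReal.ofReal (Real.log 2 / Real.log 3) ∧
    -- the quantization dimensions of `P₁` and `P` exist and equal that number
    Quantization.HasQuantizationDimension P₁ ((Real.log 2 / Real.log 3 : ℝ) : EReal) ∧
    Quantization.HasQuantizationDimension (Quantization.mixedDistribution P₁)
      ((Real.log 2 / Real.log 3 : ℝ) : EReal) ∧
    -- the lower and upper coefficients of `P` are half of those of `P₁`
    Quantization.lowerQuantizationCoefficient (Quantization.mixedDistribution P₁)
        (Real.log 2 / Real.log 3)
      = 2⁻¹ * Quantization.lowerQuantizationCoefficient P₁ (Real.log 2 / Real.log 3) ∧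
    Quantization.upperQuantizationCoefficient (Quantization.mixedDistribution P₁)
        (Real.log 2 / Real.log 3)
      = 2⁻¹ * Quantization.upperQuantizationCoefficient P₁ (Real.log 2 / Real.log 3) ∧
    -- the coefficients of `P₁` and `P` do not exist
    (¬ ∃ c : ℝ≥0∞, Quantization.HasQuantizationCoefficient P₁ (Real.log 2 / Real.log 3) c) ∧
    (¬ ∃ c : ℝ≥0∞, Quantization.HasQuantizationCoefficient (Quantization.mixedDistribution P₁)
      (Real.log 2 / Real.log 3) c) := by
  exact ⟨Quantization.dimH_cantorC hP₁, hP₁.hasQuantizationDimension,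
    hP₁.hasQuantizationDimension_mixedDistribution,
    Quantization.liminf_scaledError_mixedDistribution P₁,
    Quantization.limsup_scaledError_mixedDistribution P₁,
    fun ⟨c, hc⟩ => hP₁.not_tendsto_scaledError c hc,
    fun ⟨c, hc⟩ => hP₁.not_tendsto_scaledError_mixedDistribution c hc⟩
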